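/- Let $n\ge 3$ be an integer, $\alpha=e^{2\pi i/2^n}$ and $d_j=1+\alpha^j+\alpha^{-j}$ for $j\in\mathbb Z$. Let $D=\langle d_1,d_3,\dots,d_{2^{n-1}-3}\rangle\le\mathbb C^*$ (a group of units of $\mathbb Z[\alpha]$), let $D^m=\{d^m: d\in D\}$, and let $E=\{\lambda\in D:\lambda\equiv 1\pmod{2\mathbb Z[\alpha]}\}$, a subgroup of $D$. For $0\le k\le n-3$ put $A_k=\{1,3,5,\dots,2^{n-2-k}-1\}$ and $q(k,2l+1)=d_{2l+1}^{-1}\,d_{2^{n-1-k}-(2l+1)}$ for $2l+1\in A_k$. Let $F$ be the subgroup generated by $d_1^{2^{n-2}}$, by all $q(0,2l+1)$ with $2l+1\in A_0\setminus\{1\}$, and by all $q(k,2l+1)^{2^k}$ with $1\le k\le n-3$ and $2l+1\in A_k$. Put $\sqrt F=\{d\in D: d^2\in F\}$. Then $\sqrt F$ is a subgroup of $D$ with the following properties. 1. The quotient $\sqrt F/F$ is an elementary abelian $2$-group, and it is the internal direct product $$\sqrt F/F=\langle d_1^{2^{n-3}}F\rangle\times\prod_{k=1}^{n-3}\ \prod_{2l+1\in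 A_k}\langle q(k,2l+1)^{2^{k-1}}F\rangle .$$ 2. $D^{2^{n-2}}\le F\le\sqrt F\cap E\le\sqrt F\le D$, and for $n\ge 4$ the first and the last inclusion are strict: $D^{2^{n-2}}<F$ and $\sqrt F<D$. -/

import Mathlib

namespace CircularUnits

/-- `α = e^{2πi/2^n}`, a primitive root of unity of order `2^n`. -/
noncomputable def alpha (n : ℕ) : ℂ :=
  Complex.exp (2 * Real.pi * Complex.I / ((2 ^ n : ℕ) : ℂ))

/-- The ring `ℤ[α]`, as a subring of `ℂ`. -/
noncomputable def Zalpha (n : ℕ) : Subalgebra ℤ ℂ := Algebra.adjoin ℤ {alpha n}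

/-- `d_j = 1 + α^j + α^{-j}` for an integer `j`. -/
noncomputable def d (n : ℕ) (j : ℤ) : ℂ := 1 + alpha n ^ j + alpha n ^ (-j)

theorem alpha_prim (n : ℕ) : IsPrimitiveRoot (alpha n) (2 ^ n) :=
  Complex.isPrimitiveRoot_exp (2 ^ n) (by positivity)

theorem alpha_ne_zero (n : ℕ) : alpha n ≠ 0 := Complex.exp_ne_zero _

theorem d_ne_zero (n : ℕ) (j : ℤ) : d n j ≠ 0 := by
  intro h
  have hα := alpha_ne_zero n
  have hx : alpha n ^ j ≠ 0 := zpow_ne_zero _ hα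
  have hN : (alpha n ^ j) ^ (2 ^ n) = 1 := by
    rw [← zpow_natCast, ← zpow_mul, mul_comm, zpow_mul, zpow_natCast,
      (alpha_prim n).pow_eq_one, one_zpow]
  unfold d at h
  rw [zpow_neg] at h
  generalize alpha n ^ j = x at *
  have h2 : x ^ 2 + x + 1 = 0 := by
    have h3 : x * (1 + x + x⁻¹) = x ^ 2 + x + 1 := by field_simp; ring
    rw [← h3, h, mul_zero]
  have h3 : x ^ 3 = 1 := by linear_combination (x - 1) * h2
  have hc : Nat.Coprime 3 (2 ^ n) := Nat.Coprime.pow_right n (by norm_num)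
  have h1 : x = 1 := by
    have h4 : orderOf x ∣ Nat.gcd 3 (2 ^ n) :=
      Nat.dvd_gcd (orderOf_dvd_of_pow_eq_one h3) (orderOf_dvd_of_pow_eq_one hN)
    rw [hc.gcd_eq_one, Nat.dvd_one] at h4
    exact orderOf_eq_one_iff.mp h4
  rw [h1] at h2
  norm_num at h2

/-- `d_j` as an element of the multiplicative group `ℂˣ`. -/
noncomputable def dU (n : ℕ) (j : ℤ) : ℂˣ := Units.mk0 (d n j) (d_ne_zero n j)

/-- The group `D` generated by `d_1, d_3, …, d_{2^{n-1}-3}`. -/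
noncomputable def D (n : ℕ) : Subgroup ℂˣ :=
  Subgroup.closure {u | ∃ l : ℕ, l < 2 ^ (n - 2) - 1 ∧ u = dU n (2 * l + 1)}

theorem alpha_zpow_mem (n : ℕ) (j : ℤ) : alpha n ^ j ∈ Zalpha n := by
  have h1 : alpha n ∈ Zalpha n := Algebra.subset_adjoin rfl
  have h2 : (alpha n)⁻¹ ∈ Zalpha n := by
    have h3 : (alpha n)⁻¹ = alpha n ^ (2 ^ n - 1) := by
      refine inv_eq_of_mul_eq_one_right ?_
      rw [← pow_succ', Nat.sub_add_cancel Nat.one_le_two_pow, (alpha_prim n).pow_eq_one]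
    rw [h3]
    exact pow_mem h1 _
  rcases j with m | m
  · simpa using pow_mem h1 m
  · rw [zpow_negSucc, ← inv_pow]
    exact pow_mem h2 _

theorem d_mem (n : ℕ) (j : ℤ) : d n j ∈ Zalpha n :=
  add_mem (add_mem (one_mem _) (alpha_zpow_mem n j)) (alpha_zpow_mem n (-j))

theorem d_inv_mem (n : ℕ) (hn : n ≠ 0) (j : ℤ) (hj : Odd j) : (d n j)⁻¹ ∈ Zalpha n := by
  have hxm := alpha_zpow_mem n j
  have hN : (alpha n ^ j) ^ (2 ^ n) = 1 := by
    rw [← zpow_natCast, ← zpow_mul, mul_comm, zpow_mul, zpow_natCast,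
      (alpha_prim n).pow_eq_one, one_zpow]
  have hx1 : alpha n ^ j ≠ 1 := by
    intro h
    have h2 : ((2 ^ n : ℕ) : ℤ) ∣ j := ((alpha_prim n).zpow_eq_one_iff_dvd j).mp h
    have h3 : (2 : ℤ) ∣ j := by
      refine dvd_trans ?_ h2
      push_cast
      exact dvd_pow_self 2 hn
    exact (Int.not_even_iff_odd.mpr hj) (even_iff_two_dvd.mpr h3)
  have hx0 : alpha n ^ j ≠ 0 := zpow_ne_zero _ (alpha_ne_zero n)
  have hd : d n j = 1 + alpha n ^ j + (alpha n ^ j)⁻¹ := by rw [d, zpow_neg]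
  have hc : Nat.Coprime 3 (2 ^ n) := Nat.Coprime.pow_right n (by norm_num)
  obtain ⟨t, ht⟩ : ∃ t : ℕ, 3 * t ≡ 1 [MOD 2 ^ n] := by
    obtain ⟨t, ht⟩ := Nat.exists_mul_mod_eq_one_of_coprime hc
      (Nat.one_lt_two_pow hn)
    exact ⟨t, by rw [Nat.ModEq, ht.2, Nat.mod_eq_of_lt (Nat.one_lt_two_pow hn)]⟩
  have ht' : (alpha n ^ j) ^ (3 * t) = alpha n ^ j := by
    have h5 := pow_eq_pow_of_modEq ht hN
    simpa using h5
  rw [hd]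
  generalize alpha n ^ j = x at *
  have hg : (∑ i ∈ Finset.range t, (x ^ 3) ^ i) * (x ^ 3 - 1) = x - 1 := by
    rw [geom_sum_mul, ← pow_mul, ht']
  have key : (1 + x + x⁻¹) * (x * ∑ i ∈ Finset.range t, (x ^ 3) ^ i) = 1 := by
    have h6 : x - 1 ≠ 0 := sub_ne_zero.mpr hx1
    refine mul_left_cancel₀ h6 ?_
    have h7 : (1 + x + x⁻¹) * x = x ^ 2 + x + 1 := by field_simp; ring
    linear_combination (x - 1) * (∑ i ∈ Finset.range t, (x ^ 3) ^ i) * h7 + hg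
  rw [inv_eq_of_mul_eq_one_right key]
  exact mul_mem hxm (sum_mem fun i _ => pow_mem (pow_mem hxm 3) i)

/-- Every element of `D` is a unit of `ℤ[α]`. -/
theorem D_units (n : ℕ) (u : ℂˣ) (hu : u ∈ D n) :
    (u : ℂ) ∈ Zalpha n ∧ ((u⁻¹ : ℂˣ) : ℂ) ∈ Zalpha n := by
  induction hu using Subgroup.closure_induction with
  | mem x hx =>
    obtain ⟨l, hl, rfl⟩ := hx
    have hn : n ≠ 0 := by
      rintro rfl
      simp at hl
    refine ⟨d_mem n _, ?_⟩
    rw [Units.val_inv_eq_inv_val]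
    exact d_inv_mem n hn _ ⟨l, rfl⟩
  | one => simp [one_mem]
  | mul x y _ _ hx hy =>
    refine ⟨?_, ?_⟩
    · rw [Units.val_mul]
      exact mul_mem hx.1 hy.1
    · rw [mul_inv, Units.val_mul]
      exact mul_mem hx.2 hy.2
  | inv x _ hx => exact ⟨hx.2, by rw [inv_inv]; exact hx.1⟩

/-- `E = {λ ∈ D : λ ≡ 1 (mod 2ℤ[α])}`. -/
noncomputable def E (n : ℕ) : Subgroup ℂˣ where
  carrier := {u | u ∈ D n ∧ ∃ β ∈ Zalpha n, (u : ℂ) = 1 + 2 * β}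
  one_mem' := ⟨one_mem _, 0, zero_mem _, by simp⟩
  mul_mem' := by
    rintro u v ⟨hu, β, hβ, hu'⟩ ⟨hv, γ, hγ, hv'⟩
    refine ⟨mul_mem hu hv, β + γ + (β * γ + β * γ),
      add_mem (add_mem hβ hγ) (add_mem (mul_mem hβ hγ) (mul_mem hβ hγ)), ?_⟩
    rw [Units.val_mul, hu', hv']
    ring
  inv_mem' := by
    rintro u ⟨hu, β, hβ, hu'⟩
    refine ⟨inv_mem hu, -(β * ((u⁻¹ : ℂˣ) : ℂ)), neg_mem (mul_mem hβ (D_units n u hu).2), ?_⟩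
    have h : (u : ℂ) * ((u⁻¹ : ℂˣ) : ℂ) = 1 := u.mul_inv
    linear_combination h - ((u⁻¹ : ℂˣ) : ℂ) * hu'

/-- `A_k = {1, 3, 5, …, 2^{n-2-k} - 1}` (used for `0 ≤ k ≤ n - 3`). -/
def A (n k : ℕ) : Set ℤ := {j | Odd j ∧ 0 < j ∧ j < 2 ^ (n - 2 - k)}

/-- `q(k, j) = d_j^{-1} d_{2^{n-1-k} - j}`. -/
noncomputable def q (n k : ℕ) (j : ℤ) : ℂˣ := (dU n j)⁻¹ * dU n (2 ^ (n - 1 - k) - j)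

/-- `F_0`, generated by `q(0, j)` for `j ∈ A_0 \ {1}`. -/
noncomputable def Fzero (n : ℕ) : Subgroup ℂˣ :=
  ⨆ j ∈ A n 0 \ {1}, Subgroup.zpowers (q n 0 j)

/-- `F_k` for `1 ≤ k ≤ n - 3`, generated by `q(k, j)^{2^k}` for `j ∈ A_k`. -/
noncomputable def Fstep (n k : ℕ) : Subgroup ℂˣ :=
  ⨆ j ∈ A n k, Subgroup.zpowers (q n k j ^ 2 ^ k)

/-- `F = ⟨d_1^{2^{n-2}}⟩ F_0 F_1 ⋯ F_{n-3}`. -/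
noncomputable def F (n : ℕ) : Subgroup ℂˣ :=
  Subgroup.zpowers (dU n 1 ^ 2 ^ (n - 2)) ⊔ Fzero n ⊔ ⨆ k ∈ Finset.Icc 1 (n - 3), Fstep n k

/-- The set `√F = {d ∈ D : d² ∈ F}`. -/
def sqrtF (n : ℕ) : Set ℂˣ := {u | u ∈ D n ∧ u ^ 2 ∈ F n}

/-- The subgroup `D^m` of the `m`-th powers of elements of `D`. -/
noncomputable def Dpow (n m : ℕ) : Subgroup ℂˣ := (D n).map (powMonoidHom m)

/-- The index set of the cyclic factors of `√F / F`: the point `none` for `d_1^{2^{n-3}}`, and the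
pairs `(k, j)` with `1 ≤ k ≤ n - 3` and `j ∈ A_k`. -/
abbrev Idx (n : ℕ) : Type := Option {p : ℕ × ℤ // p.1 ∈ Finset.Icc 1 (n - 3) ∧ p.2 ∈ A n p.1}

/-- The generators `d_1^{2^{n-3}}` and `q(k, j)^{2^{k-1}}`. -/
noncomputable def gen (n : ℕ) : Idx n → ℂˣ
  | none => dU n 1 ^ 2 ^ (n - 3)
  | some p => q n p.1.1 p.1.2 ^ 2 ^ (p.1.1 - 1)

end CircularUnits

/-! ### Sublattices of a free abelian group given by divisibility of exponents -/

section

open Finset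

/-! The group `D` is free abelian, and in a suitable basis `F` is a diagonal sublattice; every claim
except `F ≤ E` then becomes divisibility of exponents. The basis is `d_1` together with the
quotients of `d_{2l+1}` by `d_{2^{t+1}-(2l+1)}`, where `2^t < 2l+1 < 2^{t+1}`. These quotients are
exactly the `q(k,j)`, and passing to them from the `d_j` is unitriangular. `F` consists of the
products whose exponent at the basis element `l` is divisible by `2^{w_l}`, and `√F` of those with
`2^{w_l-1}` instead, where `w_l = 0` imposes no condition.

Independence of the `d_j` (`dU_independent`) comes from signs. The product of `d_j` over all odd `j
< 2^{n-1}` is `-1`, so the signs, read as an element of the group algebra over `𝔽₂` of the `2`-group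
`(ℤ/2^n)ˣ/{±1}`, have augmentation one and form a unit. Taking signs of all Galois conjugates of a
relation `∏ d_j^{m_j} = ±1` shows that `m` convolved with this unit is constant, so all `m_j` have
the same parity. As `d_{2^{n-1}-1}` is left out of the generators, that parity is even; extracting
square roots repeatedly makes each `m_j` divisible by every power of two.

`F ≤ E` holds because squaring is additive modulo 2, so `d_j^{2^t} ≡ d_{2^t j}`. -/

/-- Multiplicative independence of the first `r` terms of a sequence in a commutative group. -/
def MulIndep {G : Type*} [CommGroup G] (r : ℕ) (y : ℕ → G) : Prop :=
  ∀ m : ℕ → ℤ, ∏ l ∈ range r, y l ^ m l = 1 → ∀ l < r, m l = 0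

theorem zpow_sum_eq_prod {G ι : Type*} [CommGroup G] (x : G) (s : Finset ι) (m : ι → ℤ) :
    x ^ ∑ i ∈ s, m i = ∏ i ∈ s, x ^ m i := by
  classical
  induction s using Finset.induction_on with
  | empty => simp
  | insert i s hi ih => rw [sum_insert hi, prod_insert hi, zpow_add, ih]

/-- The subgroup of the products `∏ y_l ^ m_l` with `v_l ∣ m_l`. -/
def powLattice {G : Type*} [CommGroup G] (r : ℕ) (y : ℕ → G) (v : ℕ → ℕ) : Subgroup G where
  carrier := {u | ∃ m : ℕ → ℤ, (∀ l < r, (v l : ℤ) ∣ m l) ∧ u = ∏ l ∈ range r, y l ^ m l}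
  one_mem' := ⟨0, by simp, by simp⟩
  mul_mem' := by
    rintro _ _ ⟨m, hm, rfl⟩ ⟨m', hm', rfl⟩
    refine ⟨m + m', fun l hl => dvd_add (hm l hl) (hm' l hl), ?_⟩
    simp [zpow_add, prod_mul_distrib]
  inv_mem' := by
    rintro _ ⟨m, hm, rfl⟩
    exact ⟨-m, fun l hl => (dvd_neg.mpr (hm l hl)), by simp⟩

section powLattice

variable {G : Type*} [CommGroup G] {r : ℕ} {y : ℕ → G} {v v' : ℕ → ℕ}

theorem powLattice_mono (h : ∀ l < r, v' l ∣ v l) : powLattice r y v ≤ powLattice r y v' := by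
  rintro _ ⟨m, hm, rfl⟩
  exact ⟨m, fun l hl => (Int.natCast_dvd_natCast.mpr (h l hl)).trans (hm l hl), rfl⟩

theorem zpow_mem_powLattice {l : ℕ} (hl : l < r) {a : ℤ} (h : (v l : ℤ) ∣ a) :
    y l ^ a ∈ powLattice r y v := by
  refine ⟨Pi.single l a, fun l' _ => ?_, ?_⟩
  · by_cases h' : l' = l
    · subst h'
      simpa
    · simp [h']
  · rw [prod_eq_single_of_mem l (mem_range.mpr hl) fun l' _ h' => by simp [h']]
    simp

theorem pow_mem_powLattice {l : ℕ} (hl : l < r) {a : ℕ} (h : v l ∣ a) :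
    y l ^ a ∈ powLattice r y v := by
  rw [← zpow_natCast]
  exact zpow_mem_powLattice hl (Int.natCast_dvd_natCast.mpr h)

theorem powLattice_le {K : Subgroup G} (h : ∀ l < r, y l ^ v l ∈ K) : powLattice r y v ≤ K := by
  rintro _ ⟨m, hm, rfl⟩
  refine Subgroup.prod_mem _ fun l hl => ?_
  obtain ⟨c, hc⟩ := hm l (mem_range.mp hl)
  rw [hc, zpow_mul, zpow_natCast]
  exact zpow_mem (h l (mem_range.mp hl)) _

theorem MulIndep.eq_of_prod_eq (hy : MulIndep r y) {m m' : ℕ → ℤ}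
    (h : ∏ l ∈ range r, y l ^ m l = ∏ l ∈ range r, y l ^ m' l) {l : ℕ} (hl : l < r) :
    m l = m' l := by
  have := hy (m - m') (by simp [zpow_sub, prod_mul_distrib, h]) l hl
  simpa [sub_eq_zero] using this

/-- Independence makes the exponent vector unique, so membership can be tested one coordinate at a
time. -/
theorem MulIndep.prod_mem_iff (hy : MulIndep r y) (m : ℕ → ℤ) :
    ∏ l ∈ range r, y l ^ m l ∈ powLattice r y v ↔ ∀ l < r, (v l : ℤ) ∣ m l := by
  refine ⟨?_, fun h => ⟨m, h, rfl⟩⟩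
  rintro ⟨m', hm', h⟩ l hl
  rw [hy.eq_of_prod_eq h hl]
  exact hm' l hl

theorem MulIndep.zpow_mem_iff (hy : MulIndep r y) {l : ℕ} (hl : l < r) (a : ℤ) :
    y l ^ a ∈ powLattice r y v ↔ (v l : ℤ) ∣ a := by
  refine ⟨fun h => ?_, zpow_mem_powLattice hl⟩
  have h1 : y l ^ a = ∏ i ∈ range r, y i ^ (Pi.single l a : ℕ → ℤ) i := by
    rw [prod_eq_single_of_mem l (mem_range.mpr hl) fun l' _ h' => by simp [h']]
    simp
  rw [h1, hy.prod_mem_iff] at h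
  simpa using h l hl

theorem MulIndep.pow_mem_iff (hy : MulIndep r y) {l : ℕ} (hl : l < r) (a : ℕ) :
    y l ^ a ∈ powLattice r y v ↔ v l ∣ a := by
  rw [← zpow_natCast, hy.zpow_mem_iff hl, Int.natCast_dvd_natCast]

/-- The square roots of `⟨y_l ^ 2 ^ w_l⟩` in `⟨y_l⟩`. -/
theorem MulIndep.sq_mem_iff (hy : MulIndep r y) (w : ℕ → ℕ) (u : G) :
    (u ∈ powLattice r y 1 ∧ u ^ 2 ∈ powLattice r y fun l => 2 ^ w l) ↔
      u ∈ powLattice r y fun l => 2 ^ (w l - 1) := by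
  constructor
  · rintro ⟨⟨m, -, rfl⟩, h⟩
    rw [hy.prod_mem_iff]
    have h1 : (∏ l ∈ range r, y l ^ m l) ^ 2 = ∏ l ∈ range r, y l ^ (m l * 2) := by
      rw [← prod_pow]
      refine prod_congr rfl fun l _ => ?_
      rw [zpow_mul]
      norm_cast
    rw [h1, hy.prod_mem_iff] at h
    intro l hl
    have h2 := h l hl
    -- For `w l = 0` the truncated exponent `w l - 1` is again `0`, and there is nothing to divide.
    rcases hw : w l with _ | k
    · simp
    · rw [hw, pow_succ] at h2
      push_cast at h2
      exact_mod_cast Int.dvd_of_mul_dvd_mul_right (by norm_num) h2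
  · intro h
    refine ⟨powLattice_mono (fun l _ => one_dvd _) h, ?_⟩
    obtain ⟨m, hm, rfl⟩ := h
    rw [← prod_pow]
    refine Subgroup.prod_mem _ fun l hl => ?_
    rw [← zpow_natCast, ← zpow_mul]
    refine zpow_mem_powLattice (mem_range.mp hl) ?_
    have h2 : 2 ^ w l ∣ 2 ^ (w l - 1) * 2 := by
      rw [← pow_succ]
      exact pow_dvd_pow 2 (by omega)
    exact (Int.natCast_dvd_natCast.mpr h2).trans
      (by push_cast; exact mul_dvd_mul_right (by exact_mod_cast hm l (mem_range.mp hl)) 2)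

theorem powLattice_pow_le (w : ℕ → ℕ) (N : ℕ) (hw : ∀ l < r, w l ≤ N) :
    (powLattice r y 1).map (powMonoidHom (2 ^ N)) ≤ powLattice r y fun l => 2 ^ w l := by
  rw [Subgroup.map_le_iff_le_comap]
  refine powLattice_le fun l hl => ?_
  rw [Subgroup.mem_comap, Pi.one_apply, pow_one, powMonoidHom_apply]
  exact pow_mem_powLattice hl (pow_dvd_pow 2 (hw l hl))

theorem map_powMonoidHom_le (N : ℕ) :
    (powLattice r y 1).map (powMonoidHom N) ≤ powLattice r y fun _ => N := by
  rw [Subgroup.map_le_iff_le_comap]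
  refine powLattice_le fun l hl => ?_
  rw [Subgroup.mem_comap, Pi.one_apply, pow_one, powMonoidHom_apply]
  exact pow_mem_powLattice hl dvd_rfl

variable {ι : Type*} {w : ℕ → ℕ} {f : ι → ℕ} {g : ι → G}

/-- The cosets of the elements `y_l ^ 2 ^ (w_l - 1)` with `w_l ≠ 0` generate independent
subgroups modulo `⟨y_l ^ 2 ^ w_l⟩`. -/
theorem MulIndep.iSupIndep_zpowers (hy : MulIndep r y) {S F : Subgroup G}
    (hF : F = powLattice r y fun l => 2 ^ w l)
    (hf : Function.Injective f) (hfr : ∀ i, f i < r)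
    (hg : ∀ i, g i = y (f i) ^ 2 ^ (w (f i) - 1)) (hS : ∀ i, g i ∈ S) :
    iSupIndep fun i => Subgroup.zpowers (((⟨g i, hS i⟩ : S) : S ⧸ F.subgroupOf S)) := by
  intro i
  rw [Subgroup.disjoint_def]
  rintro x ⟨a, rfl⟩ hx
  -- This lattice restricts only the coordinate `f i`. It contains `F` and all the other generators,
  -- yet a power of `g i` lies in it only if it lies in `F`.
  let v : ℕ → ℕ := Function.update 1 (f i) (2 ^ w (f i))
  have hFv : F ≤ powLattice r y v := by
    rw [hF]
    refine powLattice_mono fun l _ => ?_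
    by_cases h : l = f i
    · subst h
      simp [v]
    · simp [v, h]
  have hle : (⨆ j, ⨆ (_ : j ≠ i), Subgroup.zpowers (((⟨g j, hS j⟩ : S) : S ⧸ F.subgroupOf S))) ≤
      ((powLattice r y v).subgroupOf S).map (QuotientGroup.mk' (F.subgroupOf S)) := by
    refine iSup₂_le fun j hj => ?_
    rw [Subgroup.zpowers_le]
    refine ⟨⟨g j, hS j⟩, ?_, rfl⟩
    rw [SetLike.mem_coe, Subgroup.mem_subgroupOf]
    change g j ∈ _
    rw [hg]
    refine pow_mem_powLattice (hfr j) ?_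
    simp [v, hf.ne hj]
  obtain ⟨s, hs, hsx⟩ := hle hx
  have h1 : s⁻¹ * (⟨g i, hS i⟩ : S) ^ a ∈ F.subgroupOf S := QuotientGroup.eq.mp hsx
  have h2 : g i ^ a ∈ powLattice r y v := by
    have h3 := mul_mem (show (s : G) ∈ powLattice r y v from hs)
      (hFv (show (s : G)⁻¹ * g i ^ a ∈ F from h1))
    rwa [mul_inv_cancel_left] at h3
  have hFi : g i ^ a ∈ F := by
    rw [hg, ← zpow_natCast, ← zpow_mul] at h2 ⊢
    rw [hy.zpow_mem_iff (hfr i)] at h2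
    rw [hF, hy.zpow_mem_iff (hfr i)]
    simpa [v] using h2
  exact (QuotientGroup.eq_one_iff ((⟨g i, hS i⟩ : S) ^ a)).mpr hFi

/-- The cosets of the elements `y_l ^ 2 ^ (w_l - 1)` with `w_l ≠ 0` generate
`⟨y_l ^ 2 ^ (w_l - 1)⟩` modulo `⟨y_l ^ 2 ^ w_l⟩`. -/
theorem iSup_zpowers_eq_top {S F : Subgroup G}
    (hF : F = powLattice r y fun l => 2 ^ w l) (hSl : S = powLattice r y fun l => 2 ^ (w l - 1))
    (hsurj : ∀ l < r, w l ≠ 0 → ∃ i, f i = l)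
    (hg : ∀ i, g i = y (f i) ^ 2 ^ (w (f i) - 1)) (hS : ∀ i, g i ∈ S) :
    ⨆ i, Subgroup.zpowers (((⟨g i, hS i⟩ : S) : S ⧸ F.subgroupOf S)) = ⊤ := by
  set T := ⨆ i, Subgroup.zpowers (((⟨g i, hS i⟩ : S) : S ⧸ F.subgroupOf S)) with hT
  have hle : S ≤ (T.comap (QuotientGroup.mk' (F.subgroupOf S))).map S.subtype := by
    conv_lhs => rw [hSl]
    refine powLattice_le fun l hl => ?_
    -- Here `2 ^ (w l - 1) = 2 ^ w l = 1`, so `y l` is already in `F` and needs no generator.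
    by_cases hw : w l = 0
    · have h1 : y l ^ 2 ^ (w l - 1) ∈ F := by
        rw [hF]
        exact pow_mem_powLattice hl (by simp [hw])
      have h2 : y l ^ 2 ^ (w l - 1) ∈ S := by
        rw [hSl]
        exact pow_mem_powLattice hl dvd_rfl
      refine ⟨⟨_, h2⟩, ?_, rfl⟩
      change ((⟨_, h2⟩ : S) : S ⧸ F.subgroupOf S) ∈ T
      rw [(QuotientGroup.eq_one_iff (⟨_, h2⟩ : S)).mpr h1]
      exact one_mem _
    · obtain ⟨i, rfl⟩ := hsurj l hl hw
      rw [← hg]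
      exact ⟨⟨g i, hS i⟩, (le_iSup (fun i => Subgroup.zpowers
        (((⟨g i, hS i⟩ : S) : S ⧸ F.subgroupOf S))) i) (Subgroup.mem_zpowers _), rfl⟩
  rw [eq_top_iff]
  rintro x -
  obtain ⟨s, rfl⟩ := QuotientGroup.mk_surjective x
  obtain ⟨s', hs', hss⟩ := hle s.2
  rw [← Subtype.ext hss]
  exact hs'

/-- A unitriangular change of an independent sequence. -/
theorem MulIndep.div_smaller {x : ℕ → G} (hx : MulIndep r x) {c : ℕ → ℕ}
    (hc : ∀ l, 0 < l → l < r → c l < l) (hy0 : y 0 = x 0)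
    (hy : ∀ l, 0 < l → l < r → y l = (x (c l))⁻¹ * x l) : MulIndep r y := by
  intro m hm
  have h1 : ∏ l ∈ range r, y l ^ m l =
      ∏ i ∈ range r, x i ^ (m i - ∑ l ∈ range r with 0 < l ∧ c l = i, m l) := by
    have h2 : ∀ i ∈ range r, x i ^ (m i - ∑ l ∈ range r with 0 < l ∧ c l = i, m l) =
        x i ^ m i * ∏ l ∈ range r, if 0 < l ∧ c l = i then (x i ^ m l)⁻¹ else 1 := by
      intro i _
      rw [zpow_sub, ← prod_filter, prod_inv_distrib, zpow_sum_eq_prod]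
    have h3 : ∀ l ∈ range r, y l ^ m l = x l ^ m l *
        ∏ i ∈ range r, if 0 < l ∧ c l = i then (x i ^ m l)⁻¹ else 1 := by
      intro l hl
      rw [mem_range] at hl
      rcases Nat.eq_zero_or_pos l with rfl | h0
      · simp [hy0]
      · have hcr : c l < r := (hc l h0 hl).trans hl
        simp [hy l h0 hl, h0, hcr, mul_zpow, mul_comm]
    rw [prod_congr rfl h2, prod_congr rfl h3, prod_mul_distrib, prod_mul_distrib, prod_comm]
  rw [h1] at hm
  have h4 := hx _ hm
  -- Downward induction on `l`: the correction to the exponent of `x l` involves only indices `l'`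
  -- with `c l' = l`, all larger than `l`.
  have key : ∀ t l, r ≤ l + t → l < r → m l = 0 := by
    intro t
    induction t with
    | zero => intro l h h'; omega
    | succ t ih =>
      intro l h hl
      have h5 := h4 l hl
      rw [sum_eq_zero, sub_zero] at h5
      · exact h5
      · intro l' hl'
        simp only [mem_filter, mem_range] at hl'
        have := hc l' hl'.2.1 hl'.1
        exact ih l' (by omega) hl'.1
  exact fun l hl => key r l (by omega) hl

end powLattice

/-! ### Relations between the `d_j` -/

namespace CircularUnits

theorem alpha_half (n : ℕ) : alpha (n + 1) ^ (2 ^ n) = -1 := by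
  have h := (alpha_prim (n + 1)).pow_eq_one
  have h2 : (alpha (n + 1) ^ (2 ^ n)) ^ 2 = 1 := by rw [← pow_mul, ← pow_succ, h]
  rcases eq_or_eq_neg_of_sq_eq_sq _ 1 (h2.trans (one_pow 2).symm) with h3 | h3
  · exact absurd h3 ((alpha_prim (n + 1)).pow_ne_one_of_pos_of_lt (by positivity)
      (Nat.pow_lt_pow_right (by norm_num) (by omega)))
  · exact h3

theorem alpha_succ_sq (n : ℕ) : alpha (n + 1) ^ 2 = alpha n := by
  unfold alpha
  rw [← Complex.exp_nat_mul]
  congr 1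
  push_cast
  field_simp
  ring

theorem d_neg (n : ℕ) (j : ℤ) : d n (-j) = d n j := by
  unfold d
  rw [neg_neg]
  ring

theorem d_succ_two_mul (n : ℕ) (j : ℤ) : d (n + 1) (2 * j) = d n j := by
  unfold d
  rw [← alpha_succ_sq n, ← zpow_natCast, ← zpow_mul, ← zpow_mul]
  norm_num

theorem alpha_zpow_half_sub (n : ℕ) (j : ℤ) :
    alpha (n + 1) ^ ((2 : ℤ) ^ n - j) = -alpha (n + 1) ^ (-j) := by
  have h : alpha (n + 1) ^ ((2 : ℤ) ^ n) = -1 := by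
    rw [← alpha_half n, ← zpow_natCast]
    norm_num
  rw [sub_eq_add_neg, zpow_add₀ (alpha_ne_zero _), h]
  ring

theorem d_half_sub (n : ℕ) (j : ℤ) :
    d (n + 1) (2 ^ n - j) = 1 - alpha (n + 1) ^ j - alpha (n + 1) ^ (-j) := by
  have h1 := alpha_zpow_half_sub n j
  have h2 : alpha (n + 1) ^ (-((2 : ℤ) ^ n - j)) = -alpha (n + 1) ^ j := by
    rw [zpow_neg, h1, zpow_neg, inv_neg, inv_inv]
  rw [d, h1, h2]
  ring

/-- With `s = α^j + α^{-j}` the product is `(1 + s)(1 - s) = 1 - s²`. For odd `j` this is a relative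
norm to the next lower level. -/
theorem d_mul_d_half_sub (n : ℕ) (j : ℤ) :
    d (n + 1) j * d (n + 1) (2 ^ n - j) = -d n j := by
  rw [d_half_sub, ← d_succ_two_mul n j, d, d, ← mul_neg, mul_comm 2 j,
    mul_comm 2 (-j), zpow_mul, zpow_mul]
  norm_cast
  have h : alpha (n + 1) ^ j * alpha (n + 1) ^ (-j) = 1 := by
    rw [← zpow_add₀ (alpha_ne_zero _)]
    simp
  linear_combination -2 * h

theorem d_eq_of_dvd_sub {n : ℕ} {i j : ℤ} (h : (2 : ℤ) ^ n ∣ i - j) : d n i = d n j := by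
  have h1 : ∀ i j : ℤ, (2 : ℤ) ^ n ∣ i - j → alpha n ^ i = alpha n ^ j := by
    intro i j h
    have h2 : alpha n ^ (i - j) = 1 :=
      ((alpha_prim n).zpow_eq_one_iff_dvd _).mpr (by exact_mod_cast h)
    have h3 : i = (i - j) + j := by ring
    rw [h3, zpow_add₀ (alpha_ne_zero _), h2, one_mul]
  unfold d
  rw [h1 i j h, h1 (-i) (-j) (by rw [show -i - -j = -(i - j) by ring]; exact dvd_neg.mpr h)]

/-- Pairing `j` with `2^{n-1} - j` reduces the product to the one a level below, with an even number
of signs. At the bottom remains `-(1 + i + i⁻¹) = -1`. -/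
theorem prod_d (k : ℕ) : ∏ l ∈ range (2 ^ (k + 1)), d (k + 3) (2 * l + 1) = -1 := by
  induction k with
  | zero =>
    have h := d_mul_d_half_sub 2 1
    norm_num at h
    norm_num [prod_range_succ]
    rw [h]
    have h2 := alpha_half 1
    norm_num at h2
    have h3 : (alpha 2)⁻¹ = - alpha 2 := by
      refine inv_eq_of_mul_eq_one_right ?_
      linear_combination -h2
    simp [d, h3]
  | succ k ih =>
    rw [pow_succ, mul_two, prod_range_add, ← prod_range_reflect (fun l => d _ _),
      ← prod_mul_distrib]
    have h : ∀ l ∈ range (2 ^ (k + 1)), d (k + 1 + 3) (2 * ((2 ^ (k + 1) - 1 - l : ℕ) : ℤ) + 1) *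
        d (k + 1 + 3) (2 * ((2 ^ (k + 1) + l : ℕ) : ℤ) + 1) =
        -1 * d (k + 3) (2 * ((2 ^ (k + 1) - 1 - l : ℕ) : ℤ) + 1) := by
      intro l hl
      rw [mem_range] at hl
      have h2 := d_mul_d_half_sub (k + 3) (2 * ((2 ^ (k + 1) - 1 - l : ℕ) : ℤ) + 1)
      rw [neg_one_mul, ← h2]
      congr 2
      have h3 : ((2 ^ (k + 1) - 1 - l : ℕ) : ℤ) = 2 ^ (k + 1) - 1 - l := by
        rw [Nat.cast_sub (by omega), Nat.cast_sub Nat.one_le_two_pow]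
        norm_num
      rw [h3]
      push_cast
      ring
    rw [prod_congr rfl h, prod_mul_distrib,
      prod_range_reflect (fun l => d (k + 3) (2 * (l : ℤ) + 1)), ih]
    simp [pow_succ, pow_mul, ← mul_pow]

/-! ### Signs, Galois conjugation and the group algebra -/

/-- The real number `d_j`. -/
noncomputable def dR (n : ℕ) (j : ℤ) : ℝ := (d n j).re

theorem ofReal_dR (n : ℕ) (j : ℤ) : (dR n j : ℂ) = d n j := by
  have h1 : (starRingEnd ℂ) (alpha n) = (alpha n)⁻¹ := by
    unfold alpha
    rw [← Complex.exp_conj, ← Complex.exp_neg]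
    congr 1
    simp [map_ofNat, neg_div]
  refine Complex.conj_eq_iff_re.mp ?_
  unfold d
  simp only [map_add, map_one, map_zpow₀, h1, inv_zpow', neg_neg]
  ring

theorem dR_ne_zero (n : ℕ) (j : ℤ) : dR n j ≠ 0 := by
  intro h
  have h2 := ofReal_dR n j
  rw [h, Complex.ofReal_zero] at h2
  exact d_ne_zero n j h2.symm

theorem dR_congr {n : ℕ} {i j : ℤ} (h : d n i = d n j) : dR n i = dR n j := by
  rw [dR, dR, h]

theorem prod_dR (k : ℕ) : ∏ l ∈ range (2 ^ (k + 1)), dR (k + 3) (2 * l + 1) = -1 := by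
  apply Complex.ofReal_injective
  push_cast
  simp only [ofReal_dR]
  exact prod_d k

/-- Galois conjugation: a multiplicative relation between the `d_j` remains valid after
multiplying all indices by an odd number. -/
theorem prod_dR_conj {ι : Type*} (t : Finset ι) (n : ℕ) (f : ι → ℤ) (m : ι → ℤ) (c : ℤ) (a : ℕ)
    (ha : Odd a) (h : ∏ i ∈ t, dR n (f i) ^ m i = c) : ∏ i ∈ t, dR n (a * f i) ^ m i = c := by
  have hprim := alpha_prim n
  have hint : IsIntegral ℚ (alpha n) := (hprim.isIntegral (by positivity)).tower_top
  have hco : Nat.Coprime a (2 ^ n) := (Nat.coprime_two_right.mpr ha).pow_right n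
  -- `α` and `α^a` are roots of the same cyclotomic polynomial, so `α ↦ α^a` extends to an embedding
  -- of `ℚ(α)`; it fixes the integer `c`.
  have hroot : Polynomial.aeval (alpha n ^ a) (minpoly ℚ (alpha n)) = 0 := by
    rw [← Polynomial.cyclotomic_eq_minpoly_rat hprim (by positivity),
      Polynomial.cyclotomic_eq_minpoly_rat (hprim.pow_of_coprime a hco) (by positivity)]
    exact minpoly.aeval _ _
  let x := IntermediateField.AdjoinSimple.gen ℚ (alpha n)
  obtain ⟨σ, hσ⟩ : ∃ σ : IntermediateField.adjoin ℚ {alpha n} →ₐ[ℚ] ℂ, σ x = alpha n ^ a := by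
    refine ⟨(IntermediateField.adjoin.powerBasis hint).lift (alpha n ^ a) ?_, ?_⟩
    · rwa [IntermediateField.adjoin.powerBasis_gen, IntermediateField.minpoly_gen]
    · exact (IntermediateField.adjoin.powerBasis hint).lift_gen _ _
  have h1 : ∏ i ∈ t, (1 + x ^ f i + x ^ (-f i)) ^ m i = (c : IntermediateField.adjoin ℚ {alpha n}) := by
    apply (IntermediateField.adjoin ℚ {alpha n}).val.injective
    have h2 := congrArg (fun r : ℝ => (r : ℂ)) h
    push_cast at h2
    simp only [ofReal_dR] at h2
    simp only [map_prod, map_zpow₀, map_add, map_one, map_intCast]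
    exact h2
  have h3 := congrArg σ h1
  simp only [map_prod, map_zpow₀, map_add, map_one, hσ, map_intCast] at h3
  apply Complex.ofReal_injective
  push_cast
  rw [← h3]
  refine prod_congr rfl fun i _ => ?_
  rw [ofReal_dR, d, zpow_mul, ← mul_neg, zpow_mul, zpow_natCast]

/-- A nonzero real number has sign `0` if it is positive, and `1` if it is negative. -/
noncomputable def signHom : ℝˣ →* Multiplicative (ZMod 2) where
  toFun x := Multiplicative.ofAdd (if (x : ℝ) < 0 then 1 else 0)
  map_one' := by simp
  map_mul' x y := by
    rw [← ofAdd_add]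
    refine congrArg _ ?_
    push_cast
    rcases lt_or_gt_of_ne x.ne_zero with hx | hx <;> rcases lt_or_gt_of_ne y.ne_zero with hy | hy
    · rw [if_pos hx, if_pos hy, if_neg (mul_pos_of_neg_of_neg hx hy).not_gt]
      rfl
    · rw [if_pos hx, if_neg hy.not_gt, if_pos (mul_neg_of_neg_of_pos hx hy)]
      rfl
    · rw [if_neg hx.not_gt, if_pos hy, if_pos (mul_neg_of_pos_of_neg hx hy)]
      rfl
    · rw [if_neg hx.not_gt, if_neg hy.not_gt, if_neg (mul_pos hx hy).not_gt]
      rfl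

/-- In the group algebra over `𝔽₂` of a finite abelian `2`-group, an element of augmentation one is
invertible; so a function whose convolution with it is constant is itself constant. -/
theorem const_of_convolution_const {G : Type*} [CommGroup G] [Fintype G] (k : ℕ)
    (hG : Fintype.card G = 2 ^ k) (s m : G → ZMod 2) (e : ZMod 2) (hs : ∑ g, s g = 1)
    (h : ∀ a, ∑ g, m g * s (g * a) = e) (g g' : G) : m g = m g' := by
  classical
  let S : MonoidAlgebra (ZMod 2) G := ∑ g, MonoidAlgebra.single g (s g)
  -- The inverse `g⁻¹` turns the correlation sums in `h` into the coefficients of the product `M *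
  -- S`.
  let M : MonoidAlgebra (ZMod 2) G := ∑ g, MonoidAlgebra.single g⁻¹ (m g)
  have hMS : M * S = ∑ a, MonoidAlgebra.single a e := by
    simp only [M, S, sum_mul_sum, MonoidAlgebra.single_mul_single]
    have h1 : ∀ g : G, ∑ x, MonoidAlgebra.single (g⁻¹ * x) (m g * s x) =
        ∑ a, MonoidAlgebra.single a (m g * s (g * a)) := by
      intro g
      refine Fintype.sum_equiv (Equiv.mulLeft g⁻¹) _ _ fun x => ?_
      simp
    rw [sum_congr rfl fun g _ => h1 g, sum_comm]
    refine sum_congr rfl fun a _ => ?_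
    rw [← h a]
    exact (map_sum (MonoidAlgebra.singleAddHom a) _ _).symm
  -- Frobenius raises each term separately, and `g ^ 2 ^ k = 1`, leaving the augmentation.
  have hSpow : S ^ 2 ^ k = 1 := by
    have : CharP (MonoidAlgebra (ZMod 2) G) 2 :=
      charP_of_injective_algebraMap (algebraMap (ZMod 2) (MonoidAlgebra (ZMod 2) G)).injective 2
    simp only [S]
    rw [sum_pow_char_pow]
    simp only [MonoidAlgebra.single_pow, ← hG, pow_card_eq_one]
    have h2 : ∀ x : ZMod 2, x ^ Fintype.card G = x := by
      intro x
      rw [hG]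
      exact ZMod.pow_card_pow x
    simp only [h2]
    refine (map_sum (MonoidAlgebra.singleAddHom (1 : G)) s _).symm.trans ?_
    rw [hs]
    rfl
  have hSu : IsUnit S := IsUnit.of_pow_eq_one hSpow (by positivity)
  -- `M * S` has constant coefficients, hence is invariant under translation; cancelling the unit
  -- `S` passes this on to `M`.
  have key : MonoidAlgebra.single (g⁻¹ * g') 1 * M = M := by
    refine hSu.mul_left_injective ?_
    change _ * S = _ * S
    rw [mul_assoc, hMS, mul_sum]
    simp only [MonoidAlgebra.single_mul_single, one_mul]
    exact Fintype.sum_equiv (Equiv.mulLeft (g⁻¹ * g')) _ _ fun x => rfl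
  have h1 : MonoidAlgebra.single (g⁻¹ * g') 1 * M =
      ∑ x, MonoidAlgebra.single x⁻¹ (m (x * (g⁻¹ * g'))) := by
    simp only [M, mul_sum, MonoidAlgebra.single_mul_single, one_mul]
    refine Fintype.sum_equiv (Equiv.mulRight (g⁻¹ * g')⁻¹) _ _ fun x => ?_
    simp [mul_assoc, mul_comm g']
  have coeff_sum_single : ∀ u : G → ZMod 2,
      (∑ x, MonoidAlgebra.single x⁻¹ (u x) : MonoidAlgebra (ZMod 2) G).coeff g⁻¹ = u g := by
    intro u
    simp [MonoidAlgebra.coeff_sum, Finsupp.finsetSum_apply, Finsupp.single_apply]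
  have h2 := congrArg (fun f : MonoidAlgebra (ZMod 2) G => f.coeff g⁻¹) (h1.symm.trans key)
  simp only [M, coeff_sum_single] at h2
  rw [← h2, mul_inv_cancel_left]

/-! ### Indexing the `d_j` by `(ℤ/2^n)ˣ / {±1}` -/

/-- The group `(ℤ/2^n)ˣ / {±1}`. -/
abbrev UnitsModNeg (n : ℕ) : Type :=
  (ZMod (2 ^ n))ˣ ⧸ Subgroup.zpowers (-1 : (ZMod (2 ^ n))ˣ)

theorem unitsModNeg_mk_eq {n : ℕ} {u v : (ZMod (2 ^ n))ˣ} :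
    (u : UnitsModNeg n) = v ↔ v = u ∨ v = -u := by
  rw [QuotientGroup.eq]
  constructor
  · rintro ⟨k, hk⟩
    have hk' : v = u * (-1) ^ k := by
      change (-1) ^ k = u⁻¹ * v at hk
      rw [hk, mul_inv_cancel_left]
    rcases Int.even_or_odd k with h | h
    · left
      rw [hk', h.neg_one_zpow, mul_one]
    · right
      rw [hk', h.neg_one_zpow, mul_neg_one]
  · rintro (rfl | rfl)
    · simp
    · rw [mul_neg, inv_mul_cancel]
      exact Subgroup.mem_zpowers _

theorem d_eq_of_cast {n : ℕ} {i j : ℤ} (h : (i : ZMod (2 ^ n)) = j ∨ (i : ZMod (2 ^ n)) = -j) :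
    d n i = d n j := by
  rcases h with h | h
  · refine d_eq_of_dvd_sub ?_
    have h2 := (ZMod.intCast_zmod_eq_zero_iff_dvd (i - j) (2 ^ n)).mp (by push_cast; rw [h, sub_self])
    exact_mod_cast h2
  · rw [← d_neg n j]
    refine d_eq_of_dvd_sub ?_
    have h2 := (ZMod.intCast_zmod_eq_zero_iff_dvd (i - -j) (2 ^ n)).mp (by push_cast; rw [h]; ring)
    exact_mod_cast h2

/-- An integer representing an element of `(ℤ/2^n)ˣ / {±1}`. -/
noncomputable def UnitsModNeg.rep {n : ℕ} (g : UnitsModNeg n) : ℤ :=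
  ((g.out : ZMod (2 ^ n)).val : ℤ)

/-- The arbitrary choice in `rep` is harmless: `d_j` depends only on `±j` modulo `2^n`. -/
theorem d_rep {n : ℕ} (u : (ZMod (2 ^ n))ˣ) (j : ℤ) (h : (j : ZMod (2 ^ n)) = u) :
    d n (UnitsModNeg.rep (u : UnitsModNeg n)) = d n j := by
  refine d_eq_of_cast ?_
  have h1 : ((UnitsModNeg.rep (u : UnitsModNeg n) : ℤ) : ZMod (2 ^ n)) =
      ((u : UnitsModNeg n).out : ZMod (2 ^ n)) := by
    rw [UnitsModNeg.rep, Int.cast_natCast, ZMod.natCast_zmod_val]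
  rw [h1, h]
  rcases unitsModNeg_mk_eq.mp (QuotientGroup.out_eq' (u : UnitsModNeg n)).symm with h2 | h2
  · left
    rw [h2]
  · right
    rw [h2, Units.val_neg]

/-- The residue class of the odd number `2l+1`. -/
def oddUnit (n l : ℕ) : (ZMod (2 ^ n))ˣ :=
  ZMod.unitOfCoprime (2 * l + 1) (Nat.Coprime.pow_right n (by simp))

theorem coe_oddUnit (n l : ℕ) : (oddUnit n l : ZMod (2 ^ n)) = ((2 * l + 1 : ℤ) : ZMod (2 ^ n)) := by
  rw [oddUnit, ZMod.coe_unitOfCoprime]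
  push_cast
  rfl

theorem bijective_oddUnit (n : ℕ) :
    Function.Bijective fun l : Fin (2 ^ n) => (oddUnit (n + 2) l : UnitsModNeg (n + 2)) := by
  have hpow : (2 : ℤ) ^ (n + 2) = 4 * ((2 ^ n : ℕ) : ℤ) := by push_cast; ring
  have hpow' : 2 ^ (n + 2) = 4 * 2 ^ n := by ring
  constructor
  · intro l l' h
    rw [Fin.ext_iff]
    have hl := l.2
    have hl' := l'.2
    rcases unitsModNeg_mk_eq.mp h with h | h
    · have h2 := congrArg Units.val h
      rw [coe_oddUnit, coe_oddUnit, ZMod.intCast_eq_intCast_iff_dvd_sub] at h2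
      obtain ⟨c, hc⟩ := h2
      push_cast at hc
      rw [hpow] at hc
      have hc0 : c = 0 := by
        by_contra hne
        rcases lt_or_gt_of_ne hne with h0 | h0 <;> nlinarith
      subst hc0
      omega
    · have h2 := congrArg Units.val h
      rw [Units.val_neg, coe_oddUnit, coe_oddUnit, ← Int.cast_neg,
        ZMod.intCast_eq_intCast_iff_dvd_sub] at h2
      obtain ⟨c, hc⟩ := h2
      push_cast at hc
      rw [hpow] at hc
      exfalso
      rcases lt_trichotomy c (-1) with h0 | h0 | h0
      · nlinarith
      · subst h0
        omega
      · have : 0 ≤ c := by omega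
        nlinarith
  · intro g
    obtain ⟨u, rfl⟩ := QuotientGroup.mk_surjective g
    have hu := ZMod.val_coe_unit_coprime u
    have hodd : Odd (u : ZMod (2 ^ (n + 2))).val := by
      rw [← Nat.coprime_two_right]
      exact (Nat.coprime_pow_right_iff (by omega) _ _).mp hu
    have hlt := ZMod.val_lt (u : ZMod (2 ^ (n + 2)))
    have hv := ZMod.natCast_zmod_val (u : ZMod (2 ^ (n + 2)))
    generalize (u : ZMod (2 ^ (n + 2))).val = v at hu hodd hlt hv
    obtain ⟨w, rfl⟩ := hodd
    by_cases hw : w < 2 ^ n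
    · refine ⟨⟨w, hw⟩, unitsModNeg_mk_eq.mpr (Or.inl (Units.ext ?_))⟩
      rw [coe_oddUnit, ← hv]
      push_cast
      rfl
    -- The class is represented by `2^{n+2} - (2w+1)`, the negative of `2w+1`.
    · refine ⟨⟨2 ^ (n + 1) - 1 - w, by rw [pow_succ]; omega⟩,
        unitsModNeg_mk_eq.mpr (Or.inr (Units.ext ?_))⟩
      rw [Units.val_neg, coe_oddUnit, ← hv, ← Int.cast_neg, ← Int.cast_natCast,
        ZMod.intCast_eq_intCast_iff_dvd_sub]
      refine ⟨-1, ?_⟩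
      have h3 : ((2 ^ (n + 1) - 1 - w : ℕ) : ℤ) = 2 * ((2 ^ n : ℕ) : ℤ) - 1 - w := by
        rw [pow_succ]
        omega
      push_cast [h3]
      ring

theorem exists_equiv_unitsModNeg (k : ℕ) : ∃ e : Fin (2 ^ (k + 1)) ≃ UnitsModNeg (k + 3),
    ∀ i, e i = (oddUnit (k + 3) i : UnitsModNeg (k + 3)) :=
  ⟨Equiv.ofBijective _ (bijective_oddUnit (k + 1)), fun _ => rfl⟩


/-! ### Multiplicative independence of the `d_j` -/

/-- `d_j` as a unit of `ℝ`. -/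
noncomputable def dRU (n : ℕ) (j : ℤ) : ℝˣ := Units.mk0 (dR n j) (dR_ne_zero n j)

theorem dRU_congr {n : ℕ} {i j : ℤ} (h : d n i = d n j) : dRU n i = dRU n j :=
  Units.ext (dR_congr h)

/-- Exponents in a multiplicative relation between all the `d_j` have the same parity. -/
theorem parity_of_prod_dRU (k : ℕ) (m : ℕ → ℤ) (c : ℤˣ)
    (h : ∏ l ∈ range (2 ^ (k + 1)), dRU (k + 3) (2 * l + 1) ^ m l = Units.map (Int.castRingHom ℝ) c)
    {l l' : ℕ} (hl : l < 2 ^ (k + 1)) (hl' : l' < 2 ^ (k + 1)) :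
    (m l : ZMod 2) = m l' := by
  classical
  obtain ⟨e, he⟩ := exists_equiv_unitsModNeg k
  have : Fintype (UnitsModNeg (k + 3)) := Fintype.ofEquiv _ e
  have hcard : Fintype.card (UnitsModNeg (k + 3)) = 2 ^ (k + 1) := by
    rw [← Fintype.card_congr e, Fintype.card_fin]
  let s : UnitsModNeg (k + 3) → ZMod 2 := fun g => (signHom (dRU (k + 3) g.rep)).toAdd
  have hs : ∑ g, s g = 1 := by
    rw [← e.sum_comp]
    have h1 : ∀ i, s (e i) = (signHom (dRU (k + 3) (2 * (i : ℕ) + 1))).toAdd := fun i => by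
      simp only [s]
      rw [he, dRU_congr (d_rep (oddUnit (k + 3) i) _ (coe_oddUnit _ _).symm)]
    simp only [h1]
    rw [← toAdd_prod, ← map_prod,
      Fin.prod_univ_eq_prod_range (fun i => dRU (k + 3) (2 * (i : ℕ) + 1))]
    have h2 : ∏ l ∈ range (2 ^ (k + 1)), dRU (k + 3) (2 * l + 1) = -1 := by
      apply Units.ext
      rw [Units.coe_prod]
      exact prod_dR k
    rw [h2]
    simp [signHom]
  -- The sum for `a` is the sign of the relation conjugated by `a`, whose right-hand side `±1` does
  -- not change.
  have hconv : ∀ a, ∑ g, (m (e.symm g) : ZMod 2) * s (g * a) =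
      (signHom (Units.map (Int.castRingHom ℝ) c)).toAdd := by
    intro a
    obtain ⟨u, rfl⟩ := QuotientGroup.mk_surjective a
    have hu := ZMod.val_coe_unit_coprime u
    have hodd : Odd (u : ZMod (2 ^ (k + 3))).val := by
      rw [← Nat.coprime_two_right]
      exact (Nat.coprime_pow_right_iff (by omega) _ _).mp hu
    have hv := ZMod.natCast_zmod_val (u : ZMod (2 ^ (k + 3)))
    generalize (u : ZMod (2 ^ (k + 3))).val = v at hu hodd hv
    have hr := prod_dR_conj (range (2 ^ (k + 1))) (k + 3) (fun l => 2 * (l : ℤ) + 1) m c v hodd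
      (by simpa [dRU] using congrArg Units.val h)
    have hr' : ∏ l ∈ range (2 ^ (k + 1)), dRU (k + 3) (v * (2 * l + 1)) ^ m l =
        Units.map (Int.castRingHom ℝ) c := by
      apply Units.ext
      simpa [dRU] using hr
    rw [← hr', map_prod, toAdd_prod, ← e.sum_comp, ← Fin.sum_univ_eq_sum_range
      (fun l => (signHom (dRU (k + 3) (v * (2 * l + 1)) ^ m l)).toAdd)]
    refine sum_congr rfl fun i _ => ?_
    rw [Equiv.symm_apply_apply, map_zpow, toAdd_zpow, zsmul_eq_mul]
    congr 1
    simp only [s]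
    have h3 : e i * (u : UnitsModNeg (k + 3)) =
        ((oddUnit (k + 3) i * u : (ZMod (2 ^ (k + 3)))ˣ) : UnitsModNeg (k + 3)) := by
      rw [he]
      rfl
    rw [h3, dRU_congr (d_rep _ (v * (2 * (i : ℕ) + 1)) _)]
    rw [Units.val_mul, coe_oddUnit, ← hv]
    push_cast
    ring
  have key := const_of_convolution_const (k + 1) hcard s
    (fun g => ((m (e.symm g) : ℤ) : ZMod 2)) _ hs hconv
  have key' := key (e ⟨l, hl⟩) (e ⟨l', hl'⟩)
  beta_reduce at key'
  rwa [Equiv.symm_apply_apply, Equiv.symm_apply_apply] at key'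

/-- The elements `d_1, d_3, …, d_{2^{n-1}-3}` are multiplicatively independent. -/
theorem dU_independent (k : ℕ) (m : ℕ → ℤ)
    (h : ∏ l ∈ range (2 ^ (k + 1) - 1), dU (k + 3) (2 * l + 1) ^ m l = 1) :
    ∀ l < 2 ^ (k + 1) - 1, m l = 0 := by
  set r := 2 ^ (k + 1) - 1 with hr
  have hr1 : 2 ^ (k + 1) = r + 1 := (Nat.sub_add_cancel Nat.one_le_two_pow).symm
  have heven : ∀ (c : ℤˣ) (m : ℕ → ℤ),
      ∏ l ∈ range r, dRU (k + 3) (2 * l + 1) ^ m l = Units.map (Int.castRingHom ℝ) c →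
      ∀ l < r, Even (m l) := by
    intro c m h l hl
    -- The missing factor `d_{2^{n-1}-1}` enters with exponent `0`, which forces every other
    -- exponent to be even.
    let m' : ℕ → ℤ := fun l => if l < r then m l else 0
    have h1 : ∏ l ∈ range (2 ^ (k + 1)), dRU (k + 3) (2 * l + 1) ^ m' l =
        Units.map (Int.castRingHom ℝ) c := by
      rw [hr1, prod_range_succ, ← h]
      simp only [m', lt_irrefl, if_false, zpow_zero, mul_one]
      exact prod_congr rfl fun i hi => by rw [if_pos (mem_range.mp hi)]
    have h2 := parity_of_prod_dRU k m' c h1 (l := l) (l' := r) (by omega) (by omega)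
    simp only [m', hl, lt_irrefl, if_false, if_true, Int.cast_zero] at h2
    exact ZMod.intCast_eq_zero_iff_even.mp h2
  -- The sign `c` is quantified because a square root of `1` is known only up to sign; `-1` has no
  -- real square root.
  have hdiv : ∀ (t : ℕ) (c : ℤˣ) (m : ℕ → ℤ),
      ∏ l ∈ range r, dRU (k + 3) (2 * l + 1) ^ m l = Units.map (Int.castRingHom ℝ) c →
      ∀ l < r, (2 : ℤ) ^ t ∣ m l := by
    intro t
    induction t with
    | zero => simp
    | succ t ih =>
      intro c m h
      have hev := heven c m h
      have hm : ∀ l < r, m l = 2 * (m l / 2) := fun l hl => by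
        have := hev l hl
        rw [Int.even_iff] at this
        omega
      have hsq : (∏ l ∈ range r, dRU (k + 3) (2 * l + 1) ^ (m l / 2)) ^ 2 =
          Units.map (Int.castRingHom ℝ) c := by
        rw [← h, ← prod_pow]
        refine prod_congr rfl fun l hl => ?_
        conv_rhs => rw [hm l (mem_range.mp hl)]
        rw [mul_comm 2 (m l / 2), zpow_mul]
        norm_cast
      have hsq' := congrArg Units.val hsq
      obtain ⟨c', hc'⟩ : ∃ c' : ℤˣ, ∏ l ∈ range r, dRU (k + 3) (2 * l + 1) ^ (m l / 2) =
          Units.map (Int.castRingHom ℝ) c' := by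
        generalize ∏ l ∈ range r, dRU (k + 3) (2 * l + 1) ^ (m l / 2) = x at hsq'
        rcases Int.units_eq_one_or c with rfl | rfl
        · have hx2 : (x : ℝ) ^ 2 = 1 ^ 2 := by simpa using hsq'
          rcases eq_or_eq_neg_of_sq_eq_sq _ _ hx2 with hx | hx
          · exact ⟨1, Units.ext (by simpa using hx)⟩
          · exact ⟨-1, Units.ext (by simpa using hx)⟩
        · simp at hsq'
          nlinarith [sq_nonneg (x : ℝ)]
      intro l hl
      rw [hm l hl, pow_succ']
      exact mul_dvd_mul_left 2 (ih c' _ hc' l hl)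
  have hreal : ∏ l ∈ range r, dRU (k + 3) (2 * l + 1) ^ m l = Units.map (Int.castRingHom ℝ : ℤ →* ℝ) 1 := by
    apply Units.ext
    apply Complex.ofReal_injective
    have h2 := congrArg Units.val h
    simp only [Units.coe_prod, Units.val_zpow_eq_zpow_val, dU, Units.val_mk0, Units.val_one] at h2
    simp only [Units.coe_prod, Units.val_zpow_eq_zpow_val, dRU, Units.val_mk0, map_one,
      Units.val_one, Complex.ofReal_prod, Complex.ofReal_zpow, ofReal_dR, Complex.ofReal_one, h2]
  intro l hl
  by_contra hne
  obtain ⟨t, ht⟩ := pow_unbounded_of_one_lt |m l| (by norm_num : (1 : ℤ) < 2)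
  exact hne (Int.eq_zero_of_abs_lt_dvd (hdiv t 1 m hreal l hl) ht)

/-! ### The basis adapted to `F` -/

/-- The exponent of the largest power of two below `2l+1`. -/
def oddLog (l : ℕ) : ℕ := Nat.log 2 (2 * l + 1)

/-- The index of the reflection `2^{t+1} - (2l+1)` of `2l+1`, where `2^t ≤ 2l+1 < 2^{t+1}`. -/
def reflIdx (l : ℕ) : ℕ := 2 ^ oddLog l - 1 - l

/-- The number `k` with `2^{n-2-k} ≤ 2l+1 < 2^{n-1-k}`. -/
def weight (n l : ℕ) : ℕ := n - 2 - oddLog l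

/-- The basis of `D` adapted to `F`: the element `d_1` and the `q(k, j)`, numbered by
their leading terms. -/
noncomputable def adaptedBasis (n l : ℕ) : ℂˣ :=
  if l = 0 then dU n 1 else (dU n (2 * reflIdx l + 1))⁻¹ * dU n (2 * l + 1)

theorem oddLog_zero : oddLog 0 = 0 := by simp [oddLog]

theorem oddLog_spec (l : ℕ) : 2 ^ oddLog l ≤ 2 * l + 1 ∧ 2 * l + 1 < 2 ^ (oddLog l + 1) :=
  ⟨Nat.pow_log_le_self 2 (by omega), Nat.lt_pow_succ_log_self (by norm_num) _⟩

theorem oddLog_eq {l t : ℕ} (h : 2 ^ t ≤ 2 * l + 1) (h' : 2 * l + 1 < 2 ^ (t + 1)) :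
    oddLog l = t :=
  Nat.log_eq_of_pow_le_of_lt_pow h h'

theorem oddLog_pos {l : ℕ} (hl : 0 < l) : 0 < oddLog l :=
  Nat.log_pos (by norm_num) (by omega)

theorem oddLog_le {k l : ℕ} (hl : l < 2 ^ (k + 1) - 1) : oddLog l ≤ k + 1 := by
  refine Nat.lt_succ_iff.mp (Nat.log_lt_of_lt_pow (by omega) ?_)
  rw [Nat.succ_eq_add_one, pow_succ]
  omega

theorem pow_oddLog_le {l : ℕ} (hl : 0 < l) : 2 ^ oddLog l ≤ 2 * l := by
  obtain ⟨t, ht⟩ := Nat.exists_eq_add_of_lt (oddLog_pos hl)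
  have := (oddLog_spec l).1
  rw [ht, zero_add, pow_succ] at *
  omega

theorem reflIdx_add (l : ℕ) : reflIdx l + l + 1 = 2 ^ oddLog l := by
  have := (oddLog_spec l).2
  rw [pow_succ] at this
  unfold reflIdx
  omega

theorem reflIdx_lt {l : ℕ} (hl : 0 < l) : reflIdx l < l := by
  have := pow_oddLog_le hl
  have := reflIdx_add l
  omega

theorem weight_zero (k : ℕ) : weight (k + 3) 0 = k + 1 := by simp [weight, oddLog_zero]

theorem weight_le {k l : ℕ} (hl : 0 < l) : weight (k + 3) l ≤ k := by
  have := oddLog_pos hl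
  unfold weight
  omega

theorem weight_le' (k l : ℕ) : weight (k + 3) l ≤ k + 1 := by
  unfold weight
  omega

theorem reflIdx_mem_A {k l : ℕ} (hl : 0 < l) (hlr : l < 2 ^ (k + 1) - 1) :
    (2 * reflIdx l + 1 : ℤ) ∈ A (k + 3) (weight (k + 3) l) := by
  refine ⟨⟨_, rfl⟩, by positivity, ?_⟩
  have h1 : k + 3 - 2 - weight (k + 3) l = oddLog l := by
    have := oddLog_le hlr
    unfold weight
    omega
  have h2 := pow_oddLog_le hl
  have h3 := reflIdx_add l
  rw [h1]
  have h4 : 2 * reflIdx l + 1 < 2 ^ oddLog l := by omega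
  exact_mod_cast h4

/-- This matches the removal of `1` from `A_0`: `q(0,1)` would have leading term `d_{2^{n-1}-1}`,
which is not a generator. -/
theorem reflIdx_ne_zero {k l : ℕ} (hlr : l < 2 ^ (k + 1) - 1) (hw : weight (k + 3) l = 0) :
    reflIdx l ≠ 0 := by
  have h1 : oddLog l = k + 1 := by
    have := oddLog_le hlr
    unfold weight at hw
    omega
  have h3 := reflIdx_add l
  rw [h1] at h3
  omega

theorem adaptedBasis_eq_q {k l : ℕ} (hl : 0 < l) (hlr : l < 2 ^ (k + 1) - 1) :
    adaptedBasis (k + 3) l = q (k + 3) (weight (k + 3) l) (2 * reflIdx l + 1) := by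
  have h1 : k + 3 - 1 - weight (k + 3) l = oddLog l + 1 := by
    have := oddLog_le hlr
    unfold weight
    omega
  have h2 : (2 : ℤ) ^ (oddLog l + 1) - (2 * reflIdx l + 1) = 2 * l + 1 := by
    have h3 : (reflIdx l + l + 1 : ℤ) = 2 ^ oddLog l := by exact_mod_cast reflIdx_add l
    rw [pow_succ, ← h3]
    ring
  rw [adaptedBasis, if_neg hl.ne', q, h1, h2]

theorem exists_index {k κ : ℕ} {j : ℤ} (hκ : κ ≤ k) (hj : j ∈ A (k + 3) κ)
    (h : κ = 0 → j ≠ 1) :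
    ∃ l, 0 < l ∧ l < 2 ^ (k + 1) - 1 ∧ weight (k + 3) l = κ ∧ (2 * reflIdx l + 1 : ℤ) = j := by
  obtain ⟨⟨i, rfl⟩, h0, hlt⟩ := hj
  lift i to ℕ using by omega
  obtain ⟨t, rfl⟩ := Nat.exists_eq_add_of_le hκ
  have h1 : κ + t + 3 - 2 - κ = t + 1 := by omega
  rw [h1] at hlt
  have hlt' : 2 * i + 1 < 2 ^ (t + 1) := by exact_mod_cast hlt
  -- The index is found by solving `2l+1 = 2^{t+2} - (2i+1)`, the leading index of `q(κ,j)`.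
  have hlog : oddLog (2 ^ (t + 1) - 1 - i) = t + 1 := by
    refine oddLog_eq ?_ ?_
    · omega
    · rw [pow_succ 2 (t + 1)]
      omega
  refine ⟨2 ^ (t + 1) - 1 - i, ?_, ?_, ?_, ?_⟩
  · rw [pow_succ] at *
    omega
  · rcases Nat.eq_zero_or_pos κ with rfl | hpos
    · have : i ≠ 0 := by
        rintro rfl
        exact h rfl (by norm_num)
      rw [zero_add]
      omega
    · have : 2 ^ (t + 1) < 2 ^ (κ + t + 1) := Nat.pow_lt_pow_right (by norm_num) (by omega)
      omega
  · unfold weight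
    omega
  · have h2 := reflIdx_add (2 ^ (t + 1) - 1 - i)
    rw [hlog] at h2
    have : reflIdx (2 ^ (t + 1) - 1 - i) = i := by omega
    rw [this]

theorem exists_adaptedBasis_eq_q {k κ : ℕ} {j : ℤ} (hκ : κ ≤ k) (hj : j ∈ A (k + 3) κ)
    (h : κ = 0 → j ≠ 1) :
    ∃ l, l < 2 ^ (k + 1) - 1 ∧ weight (k + 3) l = κ ∧ (2 * reflIdx l + 1 : ℤ) = j ∧
      adaptedBasis (k + 3) l = q (k + 3) κ j := by
  obtain ⟨l, h0, hl, rfl, rfl⟩ := exists_index hκ hj h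
  exact ⟨l, hl, rfl, rfl, adaptedBasis_eq_q h0 hl⟩

theorem rank_pos (k : ℕ) : 0 < 2 ^ (k + 1) - 1 := by
  rw [pow_succ]
  have := Nat.one_le_two_pow (n := k)
  omega

theorem mulIndep_adaptedBasis (k : ℕ) : MulIndep (2 ^ (k + 1) - 1) (adaptedBasis (k + 3)) := by
  have h : MulIndep (2 ^ (k + 1) - 1) fun l : ℕ => dU (k + 3) (2 * l + 1) := dU_independent k
  refine h.div_smaller (c := reflIdx) (fun l hl _ => reflIdx_lt hl) ?_ fun l hl _ => ?_
  · simp [adaptedBasis]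
  · simp [adaptedBasis, hl.ne']

theorem D_eq_powLattice (k : ℕ) :
    D (k + 3) = powLattice (2 ^ (k + 1) - 1) (adaptedBasis (k + 3)) 1 := by
  refine le_antisymm ?_ (powLattice_le fun l hl => ?_)
  · rw [D, Subgroup.closure_le]
    rintro _ ⟨l, hl, rfl⟩
    replace hl : l < 2 ^ (k + 1) - 1 := hl
    induction l using Nat.strong_induction_on with
    | _ l ih =>
      have hmem : adaptedBasis (k + 3) l ∈
          powLattice (2 ^ (k + 1) - 1) (adaptedBasis (k + 3)) 1 := by
        simpa using pow_mem_powLattice (y := adaptedBasis (k + 3)) (v := 1) (a := 1) hl dvd_rfl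
      rcases Nat.eq_zero_or_pos l with rfl | h0
      · simpa [adaptedBasis] using hmem
      · have h1 := mul_mem (ih _ (reflIdx_lt h0) ((reflIdx_lt h0).trans hl)) hmem
        rwa [adaptedBasis, if_neg h0.ne', mul_inv_cancel_left] at h1
  · rw [Pi.one_apply, pow_one]
    have hmem : ∀ i : ℕ, i < 2 ^ (k + 1) - 1 → dU (k + 3) (2 * i + 1) ∈ D (k + 3) :=
      fun i hi => Subgroup.subset_closure ⟨i, hi, rfl⟩
    rcases Nat.eq_zero_or_pos l with rfl | h0
    · simpa [adaptedBasis] using hmem 0 hl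
    · rw [adaptedBasis, if_neg h0.ne']
      exact mul_mem (inv_mem (hmem _ ((reflIdx_lt h0).trans hl))) (hmem l hl)

/-- The generators of `F` are precisely the elements `y_l ^ 2 ^ w_l`, including weight `0` for the
`q(0,j)`. -/
theorem F_eq_powLattice (k : ℕ) :
    F (k + 3) = powLattice (2 ^ (k + 1) - 1) (adaptedBasis (k + 3))
      fun l => 2 ^ weight (k + 3) l := by
  refine le_antisymm (sup_le (sup_le ?_ ?_) ?_) (powLattice_le fun l hl => ?_)
  · rw [Subgroup.zpowers_le]
    have h := pow_mem_powLattice (y := adaptedBasis (k + 3))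
      (v := fun l => 2 ^ weight (k + 3) l) (rank_pos k) dvd_rfl
    simpa [weight_zero, adaptedBasis] using h
  · refine iSup₂_le fun j hj => ?_
    obtain ⟨l, hl, hw, -, hq⟩ := exists_adaptedBasis_eq_q (Nat.zero_le k) hj.1 fun _ => hj.2
    rw [Subgroup.zpowers_le, ← hq, ← pow_one (adaptedBasis _ _)]
    exact pow_mem_powLattice hl (by rw [hw, pow_zero])
  · refine iSup₂_le fun κ hκ => iSup₂_le fun j hj => ?_
    rw [mem_Icc] at hκ
    obtain ⟨l, hl, hw, -, hq⟩ := exists_adaptedBasis_eq_q (k := k) hκ.2 hj (by omega)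
    rw [Subgroup.zpowers_le, ← hq]
    exact pow_mem_powLattice hl (by rw [hw])
  · rcases Nat.eq_zero_or_pos l with rfl | h0
    · rw [weight_zero, adaptedBasis, if_pos rfl]
      exact Subgroup.mem_sup_left (Subgroup.mem_sup_left (Subgroup.mem_zpowers _))
    · have hA := reflIdx_mem_A h0 hl
      rw [adaptedBasis_eq_q h0 hl]
      rcases Nat.eq_zero_or_pos (weight (k + 3) l) with hw | hw
      · have hne := reflIdx_ne_zero hl hw
        rw [hw] at hA ⊢
        rw [pow_zero, pow_one]
        refine le_sup_of_le_left (le_sup_right (a := Subgroup.zpowers _)) ?_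
        exact le_iSup₂_of_le (f := fun j (_ : j ∈ A (k + 3) 0 \ {1}) => Subgroup.zpowers (q (k + 3) 0 j))
          _ ⟨hA, by simp; omega⟩ le_rfl (Subgroup.mem_zpowers _)
      · refine le_sup_right (a := Subgroup.zpowers _ ⊔ Fzero (k + 3)) ?_
        refine le_iSup₂_of_le (f := fun κ (_ : κ ∈ Icc 1 (k + 3 - 3)) => Fstep (k + 3) κ)
          _ (mem_Icc.mpr ⟨hw, weight_le h0⟩) le_rfl ?_
        exact le_iSup₂_of_le (f := fun j (_ : j ∈ A (k + 3) (weight (k + 3) l)) =>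
          Subgroup.zpowers (q (k + 3) (weight (k + 3) l) j ^ 2 ^ weight (k + 3) l))
          _ hA le_rfl (Subgroup.mem_zpowers _)

theorem sqrtF_eq_powLattice (k : ℕ) :
    sqrtF (k + 3) = (powLattice (2 ^ (k + 1) - 1) (adaptedBasis (k + 3))
      fun l => 2 ^ (weight (k + 3) l - 1) : Subgroup ℂˣ) := by
  ext u
  rw [SetLike.mem_coe, ← (mulIndep_adaptedBasis k).sq_mem_iff, ← F_eq_powLattice,
    ← D_eq_powLattice]
  rfl

/-! ### Congruences modulo 2 -/

theorem d_pow_two_pow (n : ℕ) (j : ℤ) (t : ℕ) :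
    ∃ β ∈ Zalpha n, d n j ^ 2 ^ t = d n (2 ^ t * j) + 2 * β := by
  induction t with
  | zero => exact ⟨0, zero_mem _, by simp⟩
  | succ t ih =>
    obtain ⟨β, hβ, h⟩ := ih
    have hd := d_mem n (2 ^ t * j)
    have hx := alpha_zpow_mem n (2 ^ t * j)
    have hy := alpha_zpow_mem n (-(2 ^ t * j))
    have hsq : ∀ i : ℤ, alpha n ^ (2 * i) = (alpha n ^ i) ^ 2 := fun i => by
      rw [mul_comm, zpow_mul]
      norm_cast
    have h2 : d n (2 ^ (t + 1) * j) =
        1 + (alpha n ^ ((2 : ℤ) ^ t * j)) ^ 2 + (alpha n ^ (-((2 : ℤ) ^ t * j))) ^ 2 := by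
      rw [d, ← hsq, ← hsq]
      ring_nf
    refine ⟨(alpha n ^ ((2 : ℤ) ^ t * j) + alpha n ^ (-((2 : ℤ) ^ t * j)) +
      alpha n ^ ((2 : ℤ) ^ t * j) * alpha n ^ (-((2 : ℤ) ^ t * j))) +
      (d n (2 ^ t * j) * β + d n (2 ^ t * j) * β + (β * β + β * β)), ?_, ?_⟩
    · exact add_mem (add_mem (add_mem hx hy) (mul_mem hx hy)) (add_mem (add_mem (mul_mem hd hβ)
        (mul_mem hd hβ)) (add_mem (mul_mem hβ hβ) (mul_mem hβ hβ)))
    · rw [pow_succ, pow_mul, h, h2, d]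
      ring

/-- Modulo 2 the power is `d_{2^{n-2}}`, and `α^{2^{n-2}}` is a square root of `-1`, which cancels
against its inverse. -/
theorem d_one_pow_mem (k : ℕ) :
    ∃ β ∈ Zalpha (k + 3), d (k + 3) 1 ^ 2 ^ (k + 1) = 1 + 2 * β := by
  obtain ⟨β, hβ, h⟩ := d_pow_two_pow (k + 3) 1 (k + 1)
  refine ⟨β, hβ, h.trans ?_⟩
  have hz : (alpha (k + 3) ^ 2 ^ (k + 1)) ^ 2 = -1 := by
    rw [← pow_mul, ← pow_succ]
    exact alpha_half (k + 2)
  have hz' : (alpha (k + 3) ^ 2 ^ (k + 1))⁻¹ = -alpha (k + 3) ^ 2 ^ (k + 1) :=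
    inv_eq_of_mul_eq_one_right (by linear_combination -hz)
  have h3 : alpha (k + 3) ^ ((2 : ℤ) ^ (k + 1)) = alpha (k + 3) ^ 2 ^ (k + 1) := by
    exact_mod_cast zpow_natCast (alpha (k + 3)) (2 ^ (k + 1))
  rw [mul_one, d, zpow_neg, h3, hz']
  ring

/-- Numerator and denominator become `1 - s` and `1 + s` modulo 2, with `s = α^{2^κ j} + α^{-2^κ
j}`; they differ by `2s`. -/
theorem q_pow_mem {k κ : ℕ} (hκ : κ ≤ k) {j : ℤ} (hj : Odd j) :
    ∃ β ∈ Zalpha (k + 3), ((q (k + 3) κ j ^ 2 ^ κ : ℂˣ) : ℂ) = 1 + 2 * β := by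
  obtain ⟨β, hβ, h⟩ := d_pow_two_pow (k + 3) j κ
  obtain ⟨γ, hγ, h'⟩ := d_pow_two_pow (k + 3) (2 ^ (k + 3 - 1 - κ) - j) κ
  have h1 : (2 : ℤ) ^ κ * (2 ^ (k + 3 - 1 - κ) - j) = 2 ^ (k + 2) - 2 ^ κ * j := by
    rw [mul_sub, ← pow_add]
    congr 2
    omega
  rw [h1, d_half_sub] at h'
  have hinv := pow_mem (d_inv_mem (k + 3) (by omega) j hj) (2 ^ κ)
  have hne : d (k + 3) j ^ 2 ^ κ ≠ 0 := pow_ne_zero _ (d_ne_zero _ _)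
  refine ⟨(d (k + 3) j)⁻¹ ^ 2 ^ κ * (γ - β - (alpha (k + 3) ^ ((2 : ℤ) ^ κ * j) +
    alpha (k + 3) ^ (-((2 : ℤ) ^ κ * j)))), mul_mem hinv (sub_mem (sub_mem hγ hβ)
    (add_mem (alpha_zpow_mem _ _) (alpha_zpow_mem _ _))), ?_⟩
  rw [q, Units.val_pow_eq_pow_val, Units.val_mul, Units.val_inv_eq_inv_val, dU, dU,
    Units.val_mk0, Units.val_mk0, mul_pow, h', inv_pow]
  field_simp
  rw [h, d]
  ring

theorem F_le_E (k : ℕ) : F (k + 3) ≤ E (k + 3) := by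
  have hD : F (k + 3) ≤ D (k + 3) := by
    rw [F_eq_powLattice, D_eq_powLattice]
    exact powLattice_mono fun _ _ => one_dvd _
  rw [F_eq_powLattice] at hD ⊢
  refine powLattice_le fun l hl => ⟨hD (pow_mem_powLattice hl dvd_rfl), ?_⟩
  rcases Nat.eq_zero_or_pos l with rfl | h0
  · rw [weight_zero, adaptedBasis, if_pos rfl]
    exact d_one_pow_mem k
  · rw [adaptedBasis_eq_q h0 hl]
    exact q_pow_mem (weight_le h0) ⟨_, rfl⟩

/-! ### Generators of `√F / F` and conclusion -/

/-- The position in the adapted basis of a generator of `√F / F`. -/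
theorem exists_gen_index (k : ℕ) : ∃ f : Idx (k + 3) → ℕ, Function.Injective f ∧
    (∀ i, f i < 2 ^ (k + 1) - 1) ∧
    (∀ i, gen (k + 3) i = adaptedBasis (k + 3) (f i) ^ 2 ^ (weight (k + 3) (f i) - 1)) ∧
    ∀ l < 2 ^ (k + 1) - 1, weight (k + 3) l ≠ 0 → ∃ i, f i = l := by
  have hex : ∀ p : {p : ℕ × ℤ // p.1 ∈ Icc 1 (k + 3 - 3) ∧ p.2 ∈ A (k + 3) p.1},
      ∃ l, 0 < l ∧ l < 2 ^ (k + 1) - 1 ∧ weight (k + 3) l = p.1.1 ∧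
        (2 * reflIdx l + 1 : ℤ) = p.1.2 := by
    rintro ⟨⟨κ, j⟩, hκ, hj⟩
    rw [mem_Icc] at hκ
    exact exists_index hκ.2 hj fun h => absurd (h ▸ hκ.1 : 1 ≤ 0) (by norm_num)
  choose g hg0 hgr hgw hgc using hex
  -- The weight determines the dyadic range of `2l+1`, and its reflection within that range then
  -- determines `l`.
  have huniq : ∀ p l, 0 < l → weight (k + 3) l = p.1.1 → (2 * reflIdx l + 1 : ℤ) = p.1.2 →
      l < 2 ^ (k + 1) - 1 → g p = l := by
    intro p l h0 hw hc hl
    have h1 := hgw p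
    have h2 := hgc p
    have h3 := oddLog_le hl
    have h4 := oddLog_le (hgr p)
    have h5 : oddLog (g p) = oddLog l := by
      unfold weight at h1 hw
      omega
    have h6 := reflIdx_add (g p)
    have h7 := reflIdx_add l
    rw [h5] at h6
    omega
  refine ⟨fun i => i.elim 0 g, ?_, ?_, ?_, ?_⟩
  · rintro (_ | p) (_ | p') h
    · rfl
    · exact absurd h (hg0 p').ne
    · exact absurd h (hg0 p).ne'
    · change g p = g p' at h
      congr 1
      refine Subtype.ext (Prod.ext ?_ ?_)
      · rw [← hgw, ← hgw, h]
      · rw [← hgc, ← hgc, h]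
  · rintro (_ | p)
    · exact rank_pos k
    · exact hgr p
  · rintro (_ | p)
    · simp [gen, weight_zero, adaptedBasis]
    · change q _ _ _ ^ _ = adaptedBasis _ (g p) ^ 2 ^ (weight (k + 3) (g p) - 1)
      rw [adaptedBasis_eq_q (hg0 p) (hgr p), hgw, hgc]
  · intro l hl hw
    rcases Nat.eq_zero_or_pos l with rfl | h0
    · exact ⟨none, rfl⟩
    · exact ⟨some ⟨(weight (k + 3) l, 2 * reflIdx l + 1),
        mem_Icc.mpr ⟨Nat.pos_of_ne_zero hw, weight_le h0⟩, reflIdx_mem_A h0 hl⟩,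
        huniq _ l h0 rfl rfl hl⟩

end CircularUnits

end

theorem lemmal (n : ℕ) (hn : 3 ≤ n) :
    ∃ S : Subgroup ℂˣ, (S : Set ℂˣ) = CircularUnits.sqrtF n ∧
      -- the quotient is an elementary abelian 2-group, and it is the internal
      -- direct product of the cyclic groups generated by the given cosets
      (∀ x : S ⧸ (CircularUnits.F n).subgroupOf S, x ^ 2 = 1) ∧
      (∃ hg : ∀ i : CircularUnits.Idx n, CircularUnits.gen n i ∈ S,
        iSupIndep (fun i : CircularUnits.Idx n => Subgroup.zpowers
          (((⟨CircularUnits.gen n i, hg i⟩ : S) : S ⧸ (CircularUnits.F n).subgroupOf S))) ∧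
        (⨆ i : CircularUnits.Idx n, Subgroup.zpowers
          (((⟨CircularUnits.gen n i, hg i⟩ : S) : S ⧸ (CircularUnits.F n).subgroupOf S))) = ⊤) ∧
      -- the chain of subgroups, with strict inclusions at both ends for `n ≥ 4`
      CircularUnits.Dpow n (2 ^ (n - 2)) ≤ CircularUnits.F n ∧
      CircularUnits.F n ≤ S ⊓ CircularUnits.E n ∧
      S ⊓ CircularUnits.E n ≤ S ∧
      S ≤ CircularUnits.D n ∧
      (4 ≤ n → CircularUnits.Dpow n (2 ^ (n - 2)) < CircularUnits.F n ∧
        S < CircularUnits.D n) := by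
  obtain ⟨k, rfl⟩ := Nat.exists_eq_add_of_le' hn
  have hy := CircularUnits.mulIndep_adaptedBasis k
  have hF := CircularUnits.F_eq_powLattice k
  have hD := CircularUnits.D_eq_powLattice k
  obtain ⟨f, hf, hfr, hg, hsurj⟩ := CircularUnits.exists_gen_index k
  let S := powLattice (2 ^ (k + 1) - 1) (CircularUnits.adaptedBasis (k + 3))
    fun l => 2 ^ (CircularUnits.weight (k + 3) l - 1)
  have hS : (S : Set ℂˣ) = CircularUnits.sqrtF (k + 3) :=
    (CircularUnits.sqrtF_eq_powLattice k).symm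
  have hgS : ∀ i, CircularUnits.gen (k + 3) i ∈ S := fun i => by
    rw [hg]
    exact pow_mem_powLattice (hfr i) dvd_rfl
  have hFS : CircularUnits.F (k + 3) ≤ S := by
    rw [hF]
    exact powLattice_mono fun l _ => pow_dvd_pow 2 (Nat.sub_le _ _)
  have hSD : S ≤ CircularUnits.D (k + 3) := by
    rw [hD]
    exact powLattice_mono fun l _ => one_dvd _
  have hDF : CircularUnits.Dpow (k + 3) (2 ^ (k + 3 - 2)) ≤ CircularUnits.F (k + 3) := by
    rw [CircularUnits.Dpow, hF, hD]
    exact powLattice_pow_le _ _ fun l _ => CircularUnits.weight_le' k l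
  refine ⟨S, hS, ?_, ⟨hgS, ?_, ?_⟩, hDF, le_inf hFS (CircularUnits.F_le_E k), inf_le_left, hSD, ?_⟩
  · intro x
    obtain ⟨s, rfl⟩ := QuotientGroup.mk_surjective x
    refine (QuotientGroup.eq_one_iff (s ^ 2)).mpr ?_
    have hs : (s : ℂˣ) ∈ CircularUnits.sqrtF (k + 3) := hS ▸ s.2
    exact hs.2
  · exact hy.iSupIndep_zpowers hF hf hfr hg hgS
  · exact iSup_zpowers_eq_top hF rfl hsurj hg hgS
  · intro hn4
    refine ⟨lt_of_le_not_ge hDF fun h => ?_, lt_of_le_not_ge hSD fun h => ?_⟩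
    -- For `n ≥ 4` the element `q(0,3)` exists: it lies in `F` with exponent `1`, while
    -- `D^{2^{n-2}}` allows only multiples of `2^{n-2}`.
    · have h3 : (3 : ℤ) ∈ CircularUnits.A (k + 3) 0 := by
        refine ⟨by decide, by norm_num, ?_⟩
        calc (3 : ℤ) < 2 ^ 2 := by norm_num
          _ ≤ 2 ^ (k + 3 - 2 - 0) := pow_le_pow_right₀ (by norm_num) (by omega)
      obtain ⟨l, hl, hw, -, -⟩ := CircularUnits.exists_adaptedBasis_eq_q (Nat.zero_le k) h3
        (by norm_num)
      have h1 : CircularUnits.adaptedBasis (k + 3) l ^ 1 ∈ CircularUnits.F (k + 3) := by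
        rw [hF]
        exact pow_mem_powLattice hl (by rw [hw, pow_zero])
      have h2 := h h1
      rw [CircularUnits.Dpow, hD] at h2
      have h4 := (hy.pow_mem_iff hl 1).mp (map_powMonoidHom_le _ h2)
      have h5 := Nat.le_of_dvd one_pos h4
      exact absurd h5 (not_le.mpr (Nat.one_lt_two_pow (by omega)))
    -- The witness is `d_1`: its exponent in `√F` must be divisible by `2^{n-3}`, which exceeds `1`.
    · have h1 : CircularUnits.adaptedBasis (k + 3) 0 ^ 1 ∈ CircularUnits.D (k + 3) := by
        rw [hD]
        exact pow_mem_powLattice (CircularUnits.rank_pos k) dvd_rfl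
      have h4 := (hy.pow_mem_iff (CircularUnits.rank_pos k) 1).mp (h h1)
      rw [CircularUnits.weight_zero] at h4
      have h5 := Nat.le_of_dvd one_pos h4
      exact absurd h5 (not_le.mpr (Nat.one_lt_two_pow (by omega)))
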